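/- Let $\mathrm{M\ddot{o}b}$ be the group of Möbius transformations $z\mapsto \frac{az+b}{\overline{b}z+\overline{a}}$ ($a,b\in\mathbb C$, $|a|^2-|b|^2=1$) of the unit circle $S^1$, with its usual Lie group topology as the quotient $\mathrm{SU}(1,1)/\{\pm 1\}$, and let $\widetilde{\mathrm{M\ddot{o}b}}$ be its universal covering group. Let $\alpha\mapsto \tilde R_\alpha$ and $a\mapsto\tilde\tau_a$ be the continuous one-parameter subgroups of $\widetilde{\mathrm{M\ddot{o}b}}$ which lift, respectively, the rotations $R_\alpha(z)=e^{i\alpha}z$ and the translations $\tau_a$, i.e. the flow on $S^1$ of the vector field $t(e^{i\vartheta})\frac{d}{d\vartheta}$ with $t(z)=\frac12-\frac14(z+z^{-1})$; explicitly, $\frac{d}{da}\tau_a(z)=i\,t(\tau_a(z))\,\tau_a(z)$ and $\tau_0(z)=z$. Let $\tilde V$ be a strongly continuous unitary representation of $\widetilde{\mathrm{M\ddot{o}b}}$ on a complex Hilbert space, and let $H$ and $P$ be the selfadjoint generators of rotations and translations in $\tilde V$, that is, the selfadjoint operators with $\tilde V(\tilde R_\alpha)=e^{i\alpha H}$ and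 $\tilde V(\tilde\tau_a)=e^{iaP}$ for all $\alpha,a\in\mathbb R$. Then the following four conditions are equivalent: 1. $H$ is bounded from below, i.e. there is $c\in\mathbb R$ with $\langle\xi,H\xi\rangle\ge c\|\xi\|^2$ for all $\xi$ in the domain of $H$; 2. $P$ is bounded from below, i.e. there is $c\in\mathbb R$ with $\langle\xi,P\xi\rangle\ge c\|\xi\|^2$ for all $\xi$ in the domain of $P$; 3. $H\ge 0$, i.e. $\langle\xi,H\xi\rangle\ge 0$ for all $\xi$ in the domain of $H$; 4. $P\ge 0$, i.e. $\langle\xi,P\xi\rangle\ge 0$ for all $\xi$ in the domain of $P$. -/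

import Mathlib

open Complex Topology
open scoped ComplexConjugate

noncomputable section

namespace Moebius

/-! ### The group `SU(1,1)`, its action on the circle, and the Möbius group -/

/-- `SU(1,1)`: the complex matrices `!![a, b; conj b, conj a]` with `|a|² - |b|² = 1`, with the
topology of matrices. -/
def SU11 : Subgroup (Matrix.SpecialLinearGroup (Fin 2) ℂ) where
  carrier := {g | g 1 0 = conj (g 0 1) ∧ g 1 1 = conj (g 0 0)}
  mul_mem' := by
    rintro g h ⟨hg, hg'⟩ ⟨hh, hh'⟩
    constructor <;>
      simp [Matrix.SpecialLinearGroup.coe_mul, Matrix.mul_apply, Fin.sum_univ_two, hg, hg', hh,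
        hh'] <;> ring
  one_mem' := by constructor <;> simp
  inv_mem' := by
    rintro g ⟨hg, hg'⟩
    constructor <;> simp [Matrix.SpecialLinearGroup.SL2_inv_expl, hg, hg']

/-- The entry `a` of `!![a, b; conj b, conj a]`. -/
def coeffA (g : SU11) : ℂ := (g : Matrix.SpecialLinearGroup (Fin 2) ℂ) 0 0

/-- The entry `b` of `!![a, b; conj b, conj a]`. -/
def coeffB (g : SU11) : ℂ := (g : Matrix.SpecialLinearGroup (Fin 2) ℂ) 0 1

theorem SU11_ext {g h : SU11} (ha : coeffA g = coeffA h) (hb : coeffB g = coeffB h) : g = h := by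
  apply Subtype.ext
  apply Matrix.SpecialLinearGroup.ext
  intro i j
  fin_cases i <;> fin_cases j
  · exact ha
  · exact hb
  · exact g.2.1.trans ((congrArg conj hb).trans h.2.1.symm)
  · exact g.2.2.trans ((congrArg conj ha).trans h.2.2.symm)

theorem coeff_det (g : SU11) :
    coeffA g * conj (coeffA g) - coeffB g * conj (coeffB g) = 1 := by
  have h := (g : Matrix.SpecialLinearGroup (Fin 2) ℂ).det_coe
  rw [Matrix.det_fin_two] at h
  have h1 := g.2.1
  have h2 := g.2.2
  simp only [coeffA, coeffB]
  rw [← h1, ← h2]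
  exact h

theorem coeff_norm (g : SU11) : ‖coeffA g‖ ^ 2 - ‖coeffB g‖ ^ 2 = 1 := by
  have h := coeff_det g
  rw [Complex.mul_conj, Complex.mul_conj, Complex.normSq_eq_norm_sq, Complex.normSq_eq_norm_sq] at h
  exact_mod_cast h

theorem norm_coeffB_lt (g : SU11) : ‖coeffB g‖ < ‖coeffA g‖ := by
  have h := coeff_norm g
  nlinarith [norm_nonneg (coeffA g), norm_nonneg (coeffB g)]

theorem coeffA_ne_zero (g : SU11) : coeffA g ≠ 0 :=
  norm_pos_iff.1 ((norm_nonneg _).trans_lt (norm_coeffB_lt g))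

@[simp] theorem coeffA_mul (g h : SU11) :
    coeffA (g * h) = coeffA g * coeffA h + coeffB g * conj (coeffB h) := by
  have h1 := h.2.1
  simp only [coeffA, coeffB, ← h1]
  simp [Matrix.SpecialLinearGroup.coe_mul, Matrix.mul_apply, Fin.sum_univ_two]

@[simp] theorem coeffB_mul (g h : SU11) :
    coeffB (g * h) = coeffA g * coeffB h + coeffB g * conj (coeffA h) := by
  have h1 := h.2.2
  simp only [coeffA, coeffB, ← h1]
  simp [Matrix.SpecialLinearGroup.coe_mul, Matrix.mul_apply, Fin.sum_univ_two]

@[simp] theorem coeffA_one : coeffA 1 = 1 := by simp [coeffA]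
@[simp] theorem coeffB_one : coeffB 1 = 0 := by simp [coeffB]

@[simp] theorem coeffA_inv (g : SU11) : coeffA g⁻¹ = conj (coeffA g) := by
  have h := g.2.2
  simp only [coeffA, ← h]
  simp [Matrix.SpecialLinearGroup.SL2_inv_expl]

@[simp] theorem coeffB_inv (g : SU11) : coeffB g⁻¹ = -coeffB g := by
  simp [coeffB, Matrix.SpecialLinearGroup.SL2_inv_expl]

theorem continuous_coeffA : Continuous coeffA :=
  (Continuous.matrix_elem continuous_subtype_val 0 0).comp continuous_subtype_val

theorem continuous_coeffB : Continuous coeffB :=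
  (Continuous.matrix_elem continuous_subtype_val 0 1).comp continuous_subtype_val

/-- The element `!![a, b; conj b, conj a]` of `SU(1,1)`. -/
def mkSU11 (a b : ℂ) (h : a * conj a - b * conj b = 1) : SU11 :=
  ⟨⟨!![a, b; conj b, conj a], by rw [Matrix.det_fin_two_of, h]⟩, by constructor <;> simp⟩

@[simp] theorem coeffA_mk (a b : ℂ) (h) : coeffA (mkSU11 a b h) = a := by
  simp [coeffA, mkSU11]
@[simp] theorem coeffB_mk (a b : ℂ) (h) : coeffB (mkSU11 a b h) = b := by
  simp [coeffB, mkSU11]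

theorem denom_ne_zero (g : SU11) (z : Circle) :
    conj (coeffB g) * z + conj (coeffA g) ≠ 0 := by
  intro h
  have h1 := congrArg norm (eq_neg_of_add_eq_zero_left h)
  simp only [norm_mul, norm_neg, RCLike.norm_conj, Circle.norm_coe, mul_one] at h1
  exact (norm_coeffB_lt g).ne h1

/-- The Möbius transformation `z ↦ (a z + b) / (conj b z + conj a)` of the unit circle. -/
def circleMap (g : SU11) (z : Circle) : Circle where
  val := (coeffA g * z + coeffB g) / (conj (coeffB g) * z + conj (coeffA g))
  property := by
    have h0 := denom_ne_zero g z
    have hz : conj (z : ℂ) * z = 1 := by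
      rw [← Circle.coe_inv_eq_conj, ← Circle.coe_mul]; simp
    have h1 : conj (coeffA g * z + coeffB g) * z = conj (coeffB g) * z + conj (coeffA g) := by
      simp only [map_add, map_mul]
      linear_combination conj (coeffA g) * hz
    have h2 := congrArg norm h1
    rw [norm_mul, Circle.norm_coe, mul_one, RCLike.norm_conj] at h2
    refine mem_sphere_zero_iff_norm.2 ?_
    rw [norm_div, h2, div_self (norm_ne_zero_iff.2 h0)]

theorem coe_circleMap (g : SU11) (z : Circle) : (circleMap g z : ℂ) =
    (coeffA g * z + coeffB g) / (conj (coeffB g) * z + conj (coeffA g)) := rfl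

/-- The action of `SU(1,1)` on the unit circle by Möbius transformations. -/
instance : MulAction SU11 Circle where
  smul := circleMap
  one_smul z := by
    apply Circle.ext
    change (circleMap 1 z : ℂ) = z
    simp [coe_circleMap]
  mul_smul g h z := by
    apply Circle.ext
    change (circleMap (g * h) z : ℂ) = circleMap g (circleMap h z)
    have h1 := denom_ne_zero (g * h) z
    have h2 := denom_ne_zero h z
    have h3 := denom_ne_zero g (circleMap h z)
    simp only [coe_circleMap, coeffA_mul, coeffB_mul, map_add, map_mul, Complex.conj_conj] at *
    rw [div_eq_div_iff h1 h3]
    field_simp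
    ring

theorem coe_smul_circle (g : SU11) (z : Circle) : ((g • z : Circle) : ℂ) =
    (coeffA g * z + coeffB g) / (conj (coeffB g) * z + conj (coeffA g)) := rfl

/-- The Möbius group, i.e. the group of Möbius transformations of the unit circle: the image of
`SU(1,1)` in the permutations of the circle, presented as the quotient of `SU(1,1)` by the kernel of
the action. It carries the quotient topology. -/
abbrev Mob : Type := SU11 ⧸ (MulAction.toPermHom SU11 Circle).ker

/-- The (faithful) action of the Möbius group on the unit circle. -/
def Mob.toPerm : Mob →* Equiv.Perm Circle := QuotientGroup.kerLift (MulAction.toPermHom SU11 Circle)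

theorem Mob.toPerm_injective : Function.Injective Mob.toPerm := QuotientGroup.kerLift_injective _

theorem Mob.toPerm_mk (g : SU11) (z : Circle) :
    Mob.toPerm (QuotientGroup.mk g) z = g • z := rfl

/-! ### The universal covering group of the Möbius group -/

/-- The complex number `a(gh) / (a(g) a(h)) = 1 + b(g) conj b(h) / (a(g) a(h))`, which lies in the
right half plane. -/
def cocycle (g h : SU11) : ℂ := coeffA (g * h) / (coeffA g * coeffA h)

theorem cocycle_re_pos (g h : SU11) : 0 < (cocycle g h).re := by
  have hg := coeffA_ne_zero g
  have hh := coeffA_ne_zero h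
  have h1 : cocycle g h = 1 + coeffB g * conj (coeffB h) / (coeffA g * coeffA h) := by
    rw [cocycle, coeffA_mul]; field_simp
  have h2 : ‖coeffB g * conj (coeffB h) / (coeffA g * coeffA h)‖ < 1 := by
    rw [norm_div, norm_mul, norm_mul, RCLike.norm_conj, div_lt_one
      (mul_pos (norm_pos_iff.2 hg) (norm_pos_iff.2 hh))]
    exact mul_lt_mul'' (norm_coeffB_lt g) (norm_coeffB_lt h) (norm_nonneg _) (norm_nonneg _)
  have h3 := (abs_le.1 (Complex.abs_re_le_norm
    (coeffB g * conj (coeffB h) / (coeffA g * coeffA h)))).1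
  rw [h1, Complex.add_re, Complex.one_re]
  linarith

theorem abs_arg_cocycle_lt (g h : SU11) : |(cocycle g h).arg| < Real.pi / 2 :=
  Complex.abs_arg_lt_pi_div_two_iff.2 (Or.inl (cocycle_re_pos g h))

/-- The universal covering group of the Möbius group: the pairs of an element
`!![a, b; conj b, conj a]` of `SU(1,1)` and a real number `ω` which is a value of the argument of
`a`, with the topology induced from `SU(1,1) × ℝ`. -/
def MobTilde : Type := {x : SU11 × ℝ // coeffA x.1 = ‖coeffA x.1‖ * exp (x.2 * I)}

namespace MobTilde

instance : TopologicalSpace MobTilde := instTopologicalSpaceSubtype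

/-- The underlying element of `SU(1,1)`. -/
def mat (x : MobTilde) : SU11 := x.1.1

/-- The chosen value of the argument of `a`. -/
def angle (x : MobTilde) : ℝ := x.1.2

theorem coeffA_mat (x : MobTilde) : coeffA x.mat = ‖coeffA x.mat‖ * exp (x.angle * I) := x.2

theorem continuous_mat : Continuous mat := continuous_fst.comp continuous_subtype_val

theorem continuous_angle : Continuous angle := continuous_snd.comp continuous_subtype_val

@[ext] theorem ext {x y : MobTilde} (h : x.mat = y.mat) (h' : x.angle = y.angle) : x = y :=
  Subtype.ext (Prod.ext h h')

/-- Two points over the same matrix whose angles differ by less than `2π` are equal. -/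
theorem ext_of_abs_lt {x y : MobTilde} (h : x.mat = y.mat)
    (h' : |x.angle - y.angle| < 2 * Real.pi) : x = y := by
  refine ext h ?_
  have hx := x.coeffA_mat
  have hy := y.coeffA_mat
  rw [← h] at hy
  have hn : (‖coeffA x.mat‖ : ℂ) ≠ 0 :=
    Complex.ofReal_ne_zero.2 (norm_ne_zero_iff.2 (coeffA_ne_zero _))
  have he := mul_left_cancel₀ hn (hx.symm.trans hy)
  obtain ⟨n, hn⟩ := Complex.exp_eq_exp_iff_exists_int.1 he
  have h1 : x.angle = y.angle + n * (2 * Real.pi) := by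
    have h2 := congrArg Complex.im hn
    simpa using h2
  rw [h1, add_sub_cancel_left, abs_mul, abs_of_pos Real.two_pi_pos] at h'
  have h3 : |(n : ℝ)| < 1 := by
    by_contra h4
    nlinarith [Real.two_pi_pos]
  have h5 : n = 0 := by
    rw [← Int.cast_abs] at h3
    exact Int.abs_lt_one_iff.1 (by exact_mod_cast h3)
  simp [h1, h5]

/-- The product `(g, ω) (g', ω') = (g g', ω + ω' + Arg (a(gg') / (a(g) a(g'))))`, with the principal
value of the argument of a number in the right half plane. -/
instance : Mul MobTilde where
  mul x y := ⟨(x.mat * y.mat, x.angle + y.angle + (cocycle x.mat y.mat).arg), by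
    have hx := x.coeffA_mat
    have hy := y.coeffA_mat
    have h1 : coeffA (x.mat * y.mat) =
        coeffA x.mat * coeffA y.mat * cocycle x.mat y.mat := by
      rw [cocycle, mul_div_cancel₀]
      exact mul_ne_zero (coeffA_ne_zero _) (coeffA_ne_zero _)
    have h2 : ((x.angle + y.angle + (cocycle x.mat y.mat).arg : ℝ) : ℂ) * I =
        x.angle * I + y.angle * I + (cocycle x.mat y.mat).arg * I := by
      push_cast; ring
    change coeffA (x.mat * y.mat) = ‖coeffA (x.mat * y.mat)‖ *
      exp ((x.angle + y.angle + (cocycle x.mat y.mat).arg : ℝ) * I)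
    rw [h2, Complex.exp_add, Complex.exp_add, h1, norm_mul, norm_mul]
    have hc := Complex.norm_mul_exp_arg_mul_I (cocycle x.mat y.mat)
    push_cast
    calc coeffA x.mat * coeffA y.mat * cocycle x.mat y.mat
        = (‖coeffA x.mat‖ * exp (x.angle * I)) * (‖coeffA y.mat‖ * exp (y.angle * I)) *
          (‖cocycle x.mat y.mat‖ * exp ((cocycle x.mat y.mat).arg * I)) := by
            rw [← hx, ← hy, hc]
      _ = _ := by ring⟩

instance : One MobTilde where
  one := ⟨(1, 0), by simp⟩

instance : Inv MobTilde where
  inv x := ⟨(x.mat⁻¹, -x.angle), by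
    have hx := congrArg conj x.coeffA_mat
    rw [map_mul, Complex.conj_ofReal, ← Complex.exp_conj, map_mul, Complex.conj_ofReal,
      Complex.conj_I] at hx
    simpa using hx⟩

@[simp] theorem mat_mul (x y : MobTilde) : (x * y).mat = x.mat * y.mat := rfl
theorem angle_mul (x y : MobTilde) :
    (x * y).angle = x.angle + y.angle + (cocycle x.mat y.mat).arg := rfl
@[simp] theorem mat_one : (1 : MobTilde).mat = 1 := rfl
@[simp] theorem angle_one : (1 : MobTilde).angle = 0 := rfl
@[simp] theorem mat_inv (x : MobTilde) : x⁻¹.mat = x.mat⁻¹ := rfl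
@[simp] theorem angle_inv (x : MobTilde) : x⁻¹.angle = -x.angle := rfl

instance : Group MobTilde :=
  Group.ofLeftAxioms
    (fun x y z => by
      refine ext_of_abs_lt (mul_assoc x.mat y.mat z.mat) ?_
      simp only [angle_mul, mat_mul]
      have h1 := abs_lt.1 (abs_arg_cocycle_lt x.mat y.mat)
      have h2 := abs_lt.1 (abs_arg_cocycle_lt (x.mat * y.mat) z.mat)
      have h3 := abs_lt.1 (abs_arg_cocycle_lt y.mat z.mat)
      have h4 := abs_lt.1 (abs_arg_cocycle_lt x.mat (y.mat * z.mat))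
      rw [abs_lt]
      constructor <;> linarith [h1.1, h1.2, h2.1, h2.2, h3.1, h3.2, h4.1, h4.2])
    (fun x => by
      refine ext (one_mul x.mat) ?_
      simp [angle_mul, cocycle, coeffA_ne_zero])
    (fun x => by
      refine ext_of_abs_lt (inv_mul_cancel x.mat) ?_
      have h1 := abs_arg_cocycle_lt x.mat⁻¹ x.mat
      simp only [angle_mul, angle_inv, mat_inv, angle_one]
      rw [neg_add_cancel, zero_add, sub_zero]
      linarith [Real.pi_pos])

instance : IsTopologicalGroup MobTilde where
  continuous_mul := by
    have hm : Continuous fun p : MobTilde × MobTilde => p.1.mat * p.2.mat :=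
      (continuous_mat.comp continuous_fst).mul (continuous_mat.comp continuous_snd)
    have hc : Continuous fun p : MobTilde × MobTilde => cocycle p.1.mat p.2.mat :=
      (continuous_coeffA.comp hm).div
        ((continuous_coeffA.comp (continuous_mat.comp continuous_fst)).mul
          (continuous_coeffA.comp (continuous_mat.comp continuous_snd)))
        fun p => mul_ne_zero (coeffA_ne_zero _) (coeffA_ne_zero _)
    have ha : Continuous fun p : MobTilde × MobTilde => (cocycle p.1.mat p.2.mat).arg :=
      continuous_iff_continuousAt.2 fun p =>
        ContinuousAt.comp (g := Complex.arg) (f := fun p : MobTilde × MobTilde =>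
          cocycle p.1.mat p.2.mat)
          (Complex.continuousAt_arg (Or.inl (cocycle_re_pos _ _))) hc.continuousAt
    exact (hm.prodMk (((continuous_angle.comp continuous_fst).add
      (continuous_angle.comp continuous_snd)).add ha)).subtype_mk _
  continuous_inv := (continuous_mat.inv.prodMk continuous_angle.neg).subtype_mk _

/-- The covering homomorphism onto the Möbius group. -/
def toMob : MobTilde →* Mob where
  toFun x := QuotientGroup.mk x.mat
  map_one' := rfl
  map_mul' _ _ := rfl

theorem coe_toPerm_toMob (x : MobTilde) (z : Circle) : (Mob.toPerm (toMob x) z : ℂ) =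
    (coeffA x.mat * z + coeffB x.mat) / (conj (coeffB x.mat) * z + conj (coeffA x.mat)) := rfl

/-- The homeomorphism `(g, ω) ↦ (b, ω)` with `ℂ × ℝ`. -/
def homeo : MobTilde ≃ₜ ℂ × ℝ where
  toFun x := (coeffB x.mat, x.angle)
  invFun p := ⟨(mkSU11 (Real.sqrt (1 + ‖p.1‖ ^ 2) * exp (p.2 * I)) p.1 (by
      have h1 : (Real.sqrt (1 + ‖p.1‖ ^ 2) : ℂ) * Real.sqrt (1 + ‖p.1‖ ^ 2) =
          1 + (‖p.1‖ : ℂ) ^ 2 := by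
        rw [← Complex.ofReal_mul, Real.mul_self_sqrt (by positivity)]; push_cast; ring
      have h2 : exp (p.2 * I) * conj (exp (p.2 * I)) = 1 := by
        rw [Complex.mul_conj, Complex.normSq_eq_norm_sq, Complex.norm_exp_ofReal_mul_I]; simp
      rw [map_mul, Complex.conj_ofReal, Complex.mul_conj p.1, Complex.normSq_eq_norm_sq]
      push_cast
      linear_combination exp (p.2 * I) * conj (exp (p.2 * I)) * h1 + (1 + (‖p.1‖ : ℂ) ^ 2) * h2),
      p.2), by
      simp [Complex.norm_exp_ofReal_mul_I, abs_of_nonneg (Real.sqrt_nonneg _)]⟩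
  left_inv x := by
    refine ext (SU11_ext ?_ ?_) rfl
    · have h : Real.sqrt (1 + ‖coeffB x.mat‖ ^ 2) = ‖coeffA x.mat‖ := by
        rw [← coeff_norm x.mat, sub_add_cancel, Real.sqrt_sq (norm_nonneg _)]
      simp only [mat, coeffA_mk]
      change (Real.sqrt (1 + ‖coeffB x.mat‖ ^ 2) : ℂ) * exp (x.angle * I) = _
      rw [h]
      exact x.coeffA_mat.symm
    · simp only [mat, coeffB_mk]
  right_inv p := by
    refine Prod.ext ?_ rfl
    simp only [mat, coeffB_mk]
  continuous_toFun := (continuous_coeffB.comp continuous_mat).prodMk continuous_angle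
  continuous_invFun := by
    refine Continuous.subtype_mk (Continuous.prodMk ?_ continuous_snd) _
    refine Continuous.subtype_mk (Continuous.subtype_mk ?_ _) _
    refine continuous_matrix fun i j => ?_
    fin_cases i <;> fin_cases j <;> simp <;> fun_prop

theorem homeo_apply (x : MobTilde) : homeo x = (coeffB x.mat, x.angle) := rfl

instance : ContractibleSpace MobTilde := homeo.contractibleSpace

instance : SimplyConnectedSpace MobTilde := inferInstance

theorem isOpenQuotientMap_toMob : IsOpenQuotientMap toMob := by
  have hsec : ∀ g : SU11, coeffA g = ‖coeffA g‖ * exp ((coeffA g).arg * I) := fun g =>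
    (Complex.norm_mul_exp_arg_mul_I _).symm
  let s : SU11 → MobTilde := fun g => ⟨(g, (coeffA g).arg), hsec g⟩
  have hs1 : s 1 = 1 := ext rfl (by change (coeffA 1).arg = 0; simp)
  have hs : ContinuousAt s 1 := by
    have h1 : ContinuousAt (fun g : SU11 => (coeffA g).arg) 1 :=
      ContinuousAt.comp (g := Complex.arg) (f := coeffA)
        (Complex.continuousAt_arg (by simp)) continuous_coeffA.continuousAt
    exact Topology.IsInducing.subtypeVal.continuousAt_iff.2 (continuousAt_id.prodMk h1)
  let π : MobTilde →* SU11 := ⟨⟨mat, rfl⟩, fun _ _ => rfl⟩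
  have hπ : IsOpenMap π := by
    refine IsTopologicalGroup.isOpenMap_iff_nhds_one.2 ?_
    have h2 : 𝓝 (1 : SU11) = Filter.map π (Filter.map s (𝓝 1)) := by
      rw [Filter.map_map]; exact Filter.map_id.symm
    rw [h2]
    refine Filter.map_mono ?_
    have h3 := hs.tendsto
    rwa [hs1] at h3
  have hπs : Function.Surjective π := fun g => ⟨s g, rfl⟩
  exact QuotientGroup.isOpenQuotientMap_mk.comp ⟨hπs, continuous_mat, hπ⟩

theorem isDiscrete_ker_toMob : IsDiscrete (toMob.ker : Set MobTilde) := by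
  have hker : ∀ x ∈ toMob.ker, |x.angle| < Real.pi → x = 1 := by
    intro x hx hlt
    have hx' : x.mat ∈ (MulAction.toPermHom SU11 Circle).ker :=
      (QuotientGroup.eq_one_iff _).1 hx
    have h0 : ∀ z : Circle, coeffA x.mat * z + coeffB x.mat =
        z * (conj (coeffB x.mat) * z + conj (coeffA x.mat)) := by
      intro z
      have h1 : x.mat • z = z := congrArg (fun e : Equiv.Perm Circle => e z) hx'
      have h2 := congrArg (fun w : Circle => (w : ℂ)) h1
      simp only [coe_smul_circle] at h2
      rwa [div_eq_iff (denom_ne_zero _ _)] at h2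
    have e1 := h0 1
    have e2 := h0 (Circle.exp Real.pi)
    have e3 := h0 (Circle.exp (Real.pi / 2))
    have hI : exp ((Real.pi / 2 : ℝ) * I) = I := by
      push_cast; exact Complex.exp_pi_div_two_mul_I
    rw [Circle.coe_exp, Complex.exp_pi_mul_I] at e2
    rw [Circle.coe_exp, hI] at e3
    rw [Circle.coe_one] at e1
    have hb1 : coeffB x.mat = conj (coeffB x.mat) := by linear_combination (e1 + e2) / 2
    have ha1 : coeffA x.mat = conj (coeffA x.mat) := by linear_combination (e1 - e2) / 2
    have hb : coeffB x.mat = 0 := by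
      linear_combination (e3 + hb1 - I * ha1 + conj (coeffB x.mat) * Complex.I_sq) / 2
    have hn : ‖coeffA x.mat‖ = 1 := by
      have h := coeff_norm x.mat
      rw [hb, norm_zero] at h
      nlinarith [norm_nonneg (coeffA x.mat)]
    have hexp := x.coeffA_mat
    rw [hn, Complex.ofReal_one, one_mul] at hexp
    have him : Real.sin x.angle = 0 := by
      rw [← Complex.exp_ofReal_mul_I_im, ← hexp]
      exact Complex.conj_eq_iff_im.1 ha1.symm
    have hang : x.angle = 0 :=
      (Real.sin_eq_zero_iff_of_lt_of_lt (abs_lt.1 hlt).1 (abs_lt.1 hlt).2).1 him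
    refine ext (SU11_ext ?_ ?_) hang
    · rw [hexp, hang]; simp
    · rw [hb]; simp
  rw [isDiscrete_iff_discreteTopology]
  change DiscreteTopology toMob.ker
  refine discreteTopology_of_isOpen_singleton_one ?_
  have h1 : ({1} : Set toMob.ker) = (fun x : toMob.ker => |(x : MobTilde).angle|) ⁻¹'
      Set.Iio Real.pi := by
    ext x
    constructor
    · rintro rfl
      simp [Real.pi_pos]
    · intro hx
      exact Subtype.ext (hker x x.2 hx)
  rw [h1]
  exact isOpen_Iio.preimage (continuous_angle.comp continuous_subtype_val).abs

/-- `MobTilde`, which is simply connected, covers the Möbius group. -/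
theorem isCoveringMap_toMob : IsCoveringMap toMob :=
  (isOpenQuotientMap_toMob.isQuotientMap.isQuotientCoveringMap_of_isDiscrete_ker_monoidHom
    isDiscrete_ker_toMob).isCoveringMap

/-! ### Rotations and translations -/

/-- The lift of the rotations: the one-parameter group over `z ↦ exp (i α) z`. -/
def rotation (α : ℝ) : MobTilde :=
  ⟨(mkSU11 (exp ((α / 2 : ℝ) * I)) 0 (by
      rw [Complex.mul_conj, Complex.normSq_eq_norm_sq, Complex.norm_exp_ofReal_mul_I]; simp),
    α / 2), by
    simp only [coeffA_mk, Complex.norm_exp_ofReal_mul_I, Complex.ofReal_one, one_mul]⟩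

/-- The lift of the translations: the one-parameter group over the flow of the vector field
`t(z) = 1/2 - (z + z⁻¹)/4`, that is, of `dz/da = i t(z) z`. -/
def translation (a : ℝ) : MobTilde :=
  ⟨(mkSU11 (1 + (a / 4 : ℝ) * I) (-((a / 4 : ℝ) * I)) (by
      simp only [map_add, map_mul, map_neg, map_one, Complex.conj_ofReal, Complex.conj_I]; ring),
    (1 + (a / 4 : ℝ) * I).arg), by
    rw [coeffA_mk]; exact (Complex.norm_mul_exp_arg_mul_I _).symm⟩

theorem coeffA_rotation (α : ℝ) : coeffA (rotation α).mat = exp ((α / 2 : ℝ) * I) :=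
  by
  simp only [rotation, mat, coeffA_mk]

theorem coeffB_rotation (α : ℝ) : coeffB (rotation α).mat = 0 := by
  simp only [rotation, mat, coeffB_mk]

theorem coeffA_translation (a : ℝ) : coeffA (translation a).mat = 1 + (a / 4 : ℝ) * I :=
  by
  simp only [translation, mat, coeffA_mk]

theorem coeffB_translation (a : ℝ) : coeffB (translation a).mat = -((a / 4 : ℝ) * I) :=
  by
  simp only [translation, mat, coeffB_mk]

theorem abs_angle_translation_lt (a : ℝ) : |(translation a).angle| < Real.pi / 2 :=
  Complex.abs_arg_lt_pi_div_two_iff.2 (Or.inl (by simp))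

theorem rotation_add (α β : ℝ) : rotation (α + β) = rotation α * rotation β := by
  have hA : coeffA (rotation α * rotation β).mat = coeffA (rotation α).mat *
      coeffA (rotation β).mat := by
    rw [mat_mul, coeffA_mul, coeffB_rotation, zero_mul, add_zero]
  refine ext (SU11_ext ?_ ?_) ?_
  · rw [hA, coeffA_rotation, coeffA_rotation, coeffA_rotation, ← Complex.exp_add]
    congr 1; push_cast; ring
  · rw [mat_mul, coeffB_mul, coeffB_rotation, coeffB_rotation, coeffB_rotation]; simp
  · rw [angle_mul, cocycle, ← mat_mul, hA, div_self
      (mul_ne_zero (coeffA_ne_zero _) (coeffA_ne_zero _)), Complex.arg_one]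
    change (α + β) / 2 = α / 2 + β / 2 + 0
    ring

theorem continuous_rotation : Continuous rotation := by
  rw [← homeo.comp_continuous_iff]
  have h : homeo ∘ rotation = fun α => ((0 : ℂ), α / 2) := by
    funext α
    rw [Function.comp_apply, homeo_apply, coeffB_rotation]
    rfl
  rw [h]
  fun_prop

theorem toMob_rotation (α : ℝ) (z : Circle) :
    (Mob.toPerm (toMob (rotation α)) z : ℂ) = exp (α * I) * z := by
  rw [coe_toPerm_toMob, coeffB_rotation, coeffA_rotation, ← Complex.exp_conj, map_mul,
    Complex.conj_ofReal, Complex.conj_I, map_zero, zero_mul, zero_add, add_zero, div_eq_iff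
    (Complex.exp_ne_zero _), mul_right_comm, ← Complex.exp_add]
  congr 2; push_cast; ring

theorem translation_add (a b : ℝ) : translation (a + b) = translation a * translation b := by
  refine ext_of_abs_lt (SU11_ext ?_ ?_) ?_
  · rw [mat_mul, coeffA_mul]
    simp only [coeffA_translation, coeffB_translation, map_neg, map_mul, Complex.conj_ofReal,
      Complex.conj_I]
    push_cast; ring
  · rw [mat_mul, coeffB_mul]
    simp only [coeffA_translation, coeffB_translation, map_add, map_mul, map_one,
      Complex.conj_ofReal, Complex.conj_I]
    push_cast; ring
  · have h1 := abs_lt.1 (abs_angle_translation_lt (a + b))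
    have h2 := abs_lt.1 (abs_angle_translation_lt a)
    have h3 := abs_lt.1 (abs_angle_translation_lt b)
    have h4 := abs_lt.1 (abs_arg_cocycle_lt (translation a).mat (translation b).mat)
    rw [angle_mul, abs_lt]
    constructor <;> linarith [h1.1, h1.2, h2.1, h2.2, h3.1, h3.2, h4.1, h4.2]

theorem continuous_translation : Continuous translation := by
  rw [← homeo.comp_continuous_iff]
  have h : homeo ∘ translation = fun a : ℝ => (-((a / 4 : ℝ) * I), (1 + (a / 4 : ℝ) * I).arg) := by
    funext a
    rw [Function.comp_apply, homeo_apply, coeffB_translation]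
    rfl
  rw [h]
  refine Continuous.prodMk (by fun_prop) (continuous_iff_continuousAt.2 fun a => ?_)
  exact ContinuousAt.comp (g := Complex.arg) (f := fun a : ℝ => 1 + ((a / 4 : ℝ) : ℂ) * I)
    (Complex.continuousAt_arg (Or.inl (by simp))) (by fun_prop)

theorem hasDerivAt_toMob_translation (a : ℝ) (z : Circle) :
    HasDerivAt (fun s : ℝ => (Mob.toPerm (toMob (translation s)) z : ℂ))
      (I * (1 / 2 - (1 / 4) * ((Mob.toPerm (toMob (translation a)) z : ℂ) +
        (Mob.toPerm (toMob (translation a)) z : ℂ)⁻¹)) *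
        (Mob.toPerm (toMob (translation a)) z : ℂ)) a := by
  have hd := fun s : ℝ => denom_ne_zero (translation s).mat z
  simp only [coe_toPerm_toMob, coeffA_translation, coeffB_translation, map_add, map_mul, map_one,
    map_neg, Complex.conj_ofReal, Complex.conj_I] at hd ⊢
  have hz : (z : ℂ) ≠ 0 := Circle.coe_ne_zero z
  have hn : ((1 + ((a / 4 : ℝ) : ℂ) * I) * z + -(((a / 4 : ℝ) : ℂ) * I)) ≠ 0 := by
    intro h0
    have h1 := Circle.coe_ne_zero (Mob.toPerm (toMob (translation a)) z)
    rw [coe_toPerm_toMob, coeffA_translation, coeffB_translation, h0, zero_div] at h1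
    exact h1 rfl
  have hc : HasDerivAt (fun s : ℝ => ((s / 4 : ℝ) : ℂ)) (1 / 4 : ℂ) a := by
    have h := ((hasDerivAt_id a).div_const 4).ofReal_comp
    simpa using h
  have hN : HasDerivAt (fun s : ℝ => (1 + ((s / 4 : ℝ) : ℂ) * I) * z + -(((s / 4 : ℝ) : ℂ) * I))
      ((1 / 4 * I) * z + -(1 / 4 * I)) a :=
    (((hc.mul_const I).const_add 1).mul_const (z : ℂ)).add (hc.mul_const I).neg
  have hD : HasDerivAt (fun s : ℝ => -(((s / 4 : ℝ) : ℂ) * -I) * z + (1 + ((s / 4 : ℝ) : ℂ) * -I))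
      (-(1 / 4 * -I) * z + 1 / 4 * -I) a :=
    (((hc.mul_const (-I)).neg).mul_const (z : ℂ)).add ((hc.mul_const (-I)).const_add 1)
  refine (hN.div hD (hd a)).congr_deriv ?_
  have key : ∀ N D : ℂ, N ≠ 0 → D ≠ 0 →
      I * (1 / 2 - 1 / 4 * (N / D + (N / D)⁻¹)) * (N / D) = -I / 4 * (N - D) ^ 2 / D ^ 2 := by
    intro N D hN hD
    field_simp
    ring
  rw [key _ _ hn (hd a)]
  congr 1
  ring

end MobTilde

end Moebius

/-! ### Selfadjoint generators -/

section Generator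

/-- The generator `A` of a one-parameter unitary group `U(t) = exp (i t A)` (the selfadjoint operator
of Stone's theorem): its domain consists of the vectors `ξ` for which `t ↦ U(t) ξ` is differentiable
at `0`, and `A ξ = -i d/dt U(t) ξ` at `t = 0`. -/
def unitaryGenerator {E : Type*} [NormedAddCommGroup E] [InnerProductSpace ℂ E]
    (U : ℝ → E →L[ℂ] E) : E →ₗ.[ℂ] E where
  domain :=
    { carrier := {ξ | DifferentiableAt ℝ (fun t => U t ξ) 0}
      add_mem' := fun {ξ η} hξ hη => by
        have h := DifferentiableAt.fun_add hξ hη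
        simp only [← map_add] at h
        exact h
      zero_mem' := by simp
      smul_mem' := fun c ξ hξ => by
        have h := DifferentiableAt.fun_const_smul hξ c
        simp only [← map_smul] at h
        exact h }
  toFun :=
    { toFun := fun ξ => -I • deriv (fun t => U t (ξ : E)) 0
      map_add' := fun ξ η => by
        have h := deriv_fun_add ξ.2 η.2
        simp only [Submodule.coe_add, map_add]
        rw [h, smul_add]
      map_smul' := fun c ξ => by
        have h := deriv_fun_const_smul c ξ.2
        simp only [Submodule.coe_smul, map_smul, RingHom.id_apply]
        rw [h, smul_comm] }

/-- The operator `A` is bounded from below: `⟨ξ, A ξ⟩ ≥ c ‖ξ‖²` on its domain, for some real `c`. -/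
def IsBoundedFromBelow {E : Type*} [NormedAddCommGroup E] [InnerProductSpace ℂ E]
    (A : E →ₗ.[ℂ] E) : Prop :=
  ∃ c : ℝ, ∀ ξ : A.domain, c * ‖(ξ : E)‖ ^ 2 ≤ (inner ℂ (ξ : E) (A ξ)).re

/-- The operator `A` is nonnegative: `⟨ξ, A ξ⟩ ≥ 0` on its domain. -/
def IsNonnegative {E : Type*} [NormedAddCommGroup E] [InnerProductSpace ℂ E]
    (A : E →ₗ.[ℂ] E) : Prop :=
  ∀ ξ : A.domain, 0 ≤ (inner ℂ (ξ : E) (A ξ)).re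

end Generator

end

/-! ### Smearing a unitary representation against Haar measure. -/

section Smearing

open MeasureTheory
open scoped Pointwise

variable {E : Type*} [NormedAddCommGroup E] [InnerProductSpace ℂ E] [CompleteSpace E]
  {G : Type*} [Group G]

/-! On a vector `v` that is differentiable along one-parameter subgroups, with derivative `L p`
linear in the tangent vector `p`, the form `p ↦ Im ⟨v, L p⟩` is real linear on the Lie algebra. Its
value at the tangent vector of rotations or translations is the expectation of `H` or `P`. A lower
bound `c ‖v‖²` valid for one tangent vector holds on its whole adjoint orbit, because the
representation is unitary (`le_im_inner_conjugate`).

Let `q` be the value at the translation tangent and `q'` the value at its conjugate under the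
rotation by `π`. The rotation tangent is the sum of these two vectors, and the dilation with
parameter `r` multiplies them by `r ^ 2` and `r⁻¹ ^ 2`. If `H` is bounded below, then `c ‖v‖² ≤ r ^
2 q + r⁻¹ ^ 2 q'` for all `r > 0`. Dividing by `r ^ 2` and letting `r → ∞` gives `q ≥ 0`. If `P` is
bounded below, the same argument works without the second term. If `P ≥ 0`, then `q` and `q'` are
both nonnegative, hence so is their sum, the expectation of `H`.

This settles the matter on differentiable vectors. These are dense, since they contain the Gårding
vectors (`dense_differentiableVectors`), and they are invariant under the group. They therefore form
a core of each generator (`exists_core_approx`), and nonnegativity extends to the full domain. -/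

theorem norm_unitaryRep_apply (V : G →* unitary (E →L[ℂ] E)) (g : G) (ξ : E) :
    ‖(V g : E →L[ℂ] E) ξ‖ = ‖ξ‖ :=
  Unitary.norm_map (V g) ξ

theorem unitaryRep_mul_apply (V : G →* unitary (E →L[ℂ] E)) (g h : G) (ξ : E) :
    (V (g * h) : E →L[ℂ] E) ξ = (V g : E →L[ℂ] E) ((V h : E →L[ℂ] E) ξ) := by
  rw [map_mul]; rfl

theorem unitaryRep_one_apply (V : G →* unitary (E →L[ℂ] E)) (ξ : E) :
    (V 1 : E →L[ℂ] E) ξ = ξ := by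
  rw [map_one]; rfl

theorem inner_unitaryRep_apply (V : G →* unitary (E →L[ℂ] E)) (g : G) (ξ η : E) :
    inner ℂ ((V g : E →L[ℂ] E) ξ) ((V g : E →L[ℂ] E) η) = inner ℂ ξ η :=
  Unitary.inner_map_map (V g) ξ η

variable [TopologicalSpace G] [MeasurableSpace G] [BorelSpace G]
  (μ : Measure G) [μ.IsHaarMeasure]
  (V : G →* unitary (E →L[ℂ] E))

/-- The smeared vector `∫ f(g) V(g) ξ dμ(g)`. -/
noncomputable def smear (f : G → ℝ) (ξ : E) : E := ∫ g, f g • (V g : E →L[ℂ] E) ξ ∂μ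

variable {V} (hV : ∀ ξ : E, Continuous fun g : G => (V g : E →L[ℂ] E) ξ)
include hV

theorem integrable_smear {f : G → ℝ} (hf : Continuous f) (hs : HasCompactSupport f) (ξ : E) :
    Integrable (fun g => f g • (V g : E →L[ℂ] E) ξ) μ :=
  (hf.smul (hV ξ)).integrable_of_hasCompactSupport hs.smul_right

/-- Smearing with a probability density concentrated where `V` moves `ξ` by at most `ε`. -/
theorem norm_smear_sub_le {f : G → ℝ} (hf : Continuous f) (hs : HasCompactSupport f)
    (h0 : ∀ g, 0 ≤ f g) (h1 : ∫ g, f g ∂μ = 1) (ξ : E) {ε : ℝ}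
    (hε : ∀ g, f g ≠ 0 → ‖(V g : E →L[ℂ] E) ξ - ξ‖ ≤ ε) : ‖smear μ V f ξ - ξ‖ ≤ ε := by
  have hi : Integrable f μ := hf.integrable_of_hasCompactSupport hs
  have h2 : smear μ V f ξ - ξ = ∫ g, f g • ((V g : E →L[ℂ] E) ξ - ξ) ∂μ := by
    simp only [smul_sub]
    rw [integral_sub (integrable_smear μ hV hf hs ξ)
      (hi.smul_const ξ), integral_smul_const, h1, one_smul, smear]
  rw [h2]
  calc _ ≤ ∫ g, f g * ε ∂μ := by
        refine norm_integral_le_of_norm_le (hi.mul_const ε) (Filter.Eventually.of_forall fun g => ?_)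
        rw [norm_smul, Real.norm_of_nonneg (h0 g)]
        by_cases h : f g = 0
        · simp [h]
        · exact mul_le_mul_of_nonneg_left (hε g h) (h0 g)
    _ = ε := by rw [integral_mul_const, h1, one_mul]

variable [IsTopologicalGroup G]

/-- Left invariance of Haar measure moves the group element from the vector to the smearing
function, so that differentiating the vector reduces to differentiating a scalar function. -/
theorem unitaryRep_smear {f : G → ℝ} (hf : Continuous f) (hs : HasCompactSupport f) (h : G)
    (ξ : E) : (V h : E →L[ℂ] E) (smear μ V f ξ) = smear μ V (fun g => f (h⁻¹ * g)) ξ := by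
  rw [smear, smear, ← ContinuousLinearMap.integral_comp_comm _ (integrable_smear μ hV hf hs ξ),
    ← integral_mul_left_eq_self (fun g => f (h⁻¹ * g) • (V g : E →L[ℂ] E) ξ) h]
  congr 1
  funext g
  rw [inv_mul_cancel_left, unitaryRep_mul_apply, ContinuousLinearMap.map_smul_of_tower]

/-- Smeared vectors are differentiable along a one-parameter subgroup along which the smearing
function is continuously differentiable. -/
theorem hasDerivAt_unitaryRep_smear {f X : G → ℝ} (hf : Continuous f) (hs : HasCompactSupport f)
    (hX : Continuous X) {γ : ℝ → G} (hγ : Continuous γ) (hadd : ∀ s t, γ (s + t) = γ s * γ t)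
    (hd : ∀ g, HasDerivAt (fun s => f ((γ s)⁻¹ * g)) (X g) 0) (ξ : E) :
    HasDerivAt (fun s => (V (γ s) : E →L[ℂ] E) (smear μ V f ξ)) (smear μ V X ξ) 0 := by
  have hγ0 : γ 0 = 1 := by
    have := hadd 0 0
    rwa [add_zero, left_eq_mul] at this
  -- Off the support of `f`, the point `(γ s)⁻¹ * g` stays off it for small `s`, so the derivative
  -- vanishes. Thus `X` inherits compact support, and with it a uniform bound.
  have hX0 : ∀ g, g ∉ tsupport f → X g = 0 := by
    intro g hg
    have hc : ContinuousAt (fun s => (γ s)⁻¹ * g) 0 := by fun_prop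
    have he : ∀ᶠ s in 𝓝 (0 : ℝ), (γ s)⁻¹ * g ∈ (tsupport f)ᶜ :=
      hc.eventually_mem (by
        simpa [hγ0] using (isClosed_tsupport f).isOpen_compl.mem_nhds hg)
    have h0 : HasDerivAt (fun s => f ((γ s)⁻¹ * g)) 0 0 :=
      (hasDerivAt_const (0 : ℝ) (0 : ℝ)).congr_of_eventuallyEq
        (he.mono fun s hs' => image_eq_zero_of_notMem_tsupport hs')
    exact (hd g).unique h0
  have hXs : HasCompactSupport X := HasCompactSupport.intro hs hX0
  obtain ⟨C, hC⟩ := hXs.exists_bound_of_continuous hX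
  -- The group law carries the derivative from parameter `0` to every `s`.
  have hd' : ∀ g s, HasDerivAt (fun t => f ((γ t)⁻¹ * g)) (X ((γ s)⁻¹ * g)) s := by
    intro g s
    have h1 := hd ((γ s)⁻¹ * g)
    rw [← sub_self s] at h1
    have h2 := h1.comp_sub_const s s
    refine h2.congr_of_eventuallyEq (Filter.Eventually.of_forall fun t => ?_)
    simp only
    rw [← mul_assoc, ← mul_inv_rev, ← hadd, add_sub_cancel]
  -- For `|s| ≤ 1` the translates of the support all lie in this compact set, which supports the
  -- dominating function. Its closure is used below for measurability, as `G` need not be Hausdorff.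
  let K : Set G := γ '' Set.Icc (-1) 1 * tsupport f
  have hK : IsCompact K := (isCompact_Icc.image hγ).mul hs
  simp only [unitaryRep_smear μ hV hf hs]
  have key := hasDerivAt_integral_of_dominated_loc_of_deriv_le (μ := μ) (x₀ := (0 : ℝ))
    (F := fun s g => f ((γ s)⁻¹ * g) • (V g : E →L[ℂ] E) ξ)
    (F' := fun s g => X ((γ s)⁻¹ * g) • (V g : E →L[ℂ] E) ξ)
    (bound := (closure K).indicator fun _ => C * ‖ξ‖) (s := Set.Ioo (-1) 1)
    (Ioo_mem_nhds (by norm_num) (by norm_num)) ?_ ?_ ?_ ?_ ?_ ?_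
  · have := key.2
    simpa only [hγ0, inv_one, one_mul, smear] using this
  · refine Filter.Eventually.of_forall fun s => ?_
    have hc : Continuous fun g => f ((γ s)⁻¹ * g) := by fun_prop
    exact (integrable_smear μ hV hc
      (hs.comp_homeomorph (Homeomorph.mulLeft (γ s)⁻¹)) ξ).aestronglyMeasurable
  · simpa only [hγ0, inv_one, one_mul] using integrable_smear μ hV hf hs ξ
  · simpa only [hγ0, inv_one, one_mul] using (integrable_smear μ hV hX hXs ξ).aestronglyMeasurable
  · refine Filter.Eventually.of_forall fun g s hs' => ?_
    rw [norm_smul, norm_unitaryRep_apply]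
    by_cases hg : g ∈ closure K
    · rw [Set.indicator_of_mem hg]
      exact mul_le_mul_of_nonneg_right (hC _) (norm_nonneg _)
    · rw [Set.indicator_of_notMem hg, hX0, norm_zero, zero_mul]
      intro hg'
      exact hg (subset_closure ⟨γ s, ⟨s, Set.Ioo_subset_Icc_self hs', rfl⟩, _, hg',
        mul_inv_cancel_left _ _⟩)
  · rw [integrable_indicator_iff isClosed_closure.measurableSet]
    exact integrableOn_const hK.closure.measure_lt_top.ne
  · exact Filter.Eventually.of_forall fun g s _ => (hd' g s).smul_const _

end Smearing

/-! ### Generators through their graphs, and invariant cores. -/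

section Core

variable {E : Type*} [NormedAddCommGroup E] [InnerProductSpace ℂ E]

theorem inner_unitaryGenerator_re {U : ℝ → E →L[ℂ] E} (ξ : (unitaryGenerator U).domain) :
    (inner ℂ (ξ : E) (unitaryGenerator U ξ)).re =
      (inner ℂ (ξ : E) (deriv (fun t => U t (ξ : E)) 0)).im := by
  change (inner ℂ (ξ : E) (-I • deriv (fun t => U t (ξ : E)) 0)).re = _
  rw [inner_smul_right]
  simp

/-- Since `A ξ = -i d`, the expectation of `A` is `Im ⟨ξ, d⟩`. In this form bounds are statements
about pairs `(ξ, d)`, and no partially defined operator is needed. -/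
theorem forall_unitaryGenerator_iff {U : ℝ → E →L[ℂ] E} {c : ℝ} :
    (∀ ξ : (unitaryGenerator U).domain,
      c * ‖(ξ : E)‖ ^ 2 ≤ (inner ℂ (ξ : E) (unitaryGenerator U ξ)).re) ↔
    ∀ ξ d : E, HasDerivAt (fun t => U t ξ) d 0 → c * ‖ξ‖ ^ 2 ≤ (inner ℂ ξ d).im := by
  constructor
  · intro h ξ d hd
    have := h ⟨ξ, hd.differentiableAt⟩
    rw [inner_unitaryGenerator_re] at this
    simpa only [hd.deriv] using this
  · intro h ξ
    rw [inner_unitaryGenerator_re]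
    exact h ξ _ (DifferentiableAt.hasDerivAt ξ.2)

theorem isBoundedFromBelow_unitaryGenerator_iff {U : ℝ → E →L[ℂ] E} :
    IsBoundedFromBelow (unitaryGenerator U) ↔
    ∃ c : ℝ, ∀ ξ d : E, HasDerivAt (fun t => U t ξ) d 0 → c * ‖ξ‖ ^ 2 ≤ (inner ℂ ξ d).im :=
  exists_congr fun _ => forall_unitaryGenerator_iff

theorem isNonnegative_unitaryGenerator_iff {U : ℝ → E →L[ℂ] E} :
    IsNonnegative (unitaryGenerator U) ↔
    ∀ ξ d : E, HasDerivAt (fun t => U t ξ) d 0 → 0 ≤ (inner ℂ ξ d).im := by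
  have := forall_unitaryGenerator_iff (U := U) (c := 0)
  simpa only [zero_mul, IsNonnegative] using this

/-- A one-parameter group of isometries has skew-symmetric derivative. -/
theorem re_inner_hasDerivAt_eq_zero {U : ℝ → E →L[ℂ] E} (hU0 : ∀ ξ, U 0 ξ = ξ)
    (hU : ∀ t ξ, ‖U t ξ‖ = ‖ξ‖) {ξ d : E} (hd : HasDerivAt (fun t => U t ξ) d 0) :
    (inner ℂ ξ d).re = 0 := by
  have h1 := hd.inner ℂ hd
  have h2 : (fun t => inner ℂ (U t ξ) (U t ξ)) = fun _ : ℝ => ((‖ξ‖ : ℂ) ^ 2) := by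
    funext t
    rw [inner_self_eq_norm_sq_to_K, hU]; rfl
  rw [h2] at h1
  have h3 := h1.unique (hasDerivAt_const _ _)
  rw [hU0, ← inner_conj_symm d ξ] at h3
  have h4 := congrArg Complex.re h3
  simp only [Complex.add_re, Complex.conj_re, Complex.zero_re] at h4
  linarith

variable [CompleteSpace E]

/-- A dense subspace of differentiable vectors which is invariant under a one-parameter unitary group
is a core of its generator. -/
theorem exists_core_approx {U : ℝ → E →L[ℂ] E} (hU0 : ∀ ξ, U 0 ξ = ξ)
    (hadd : ∀ s t ξ, U (s + t) ξ = U s (U t ξ)) (hU : ∀ t ξ, ‖U t ξ‖ = ‖ξ‖)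
    (D : Submodule ℂ E) (hD : Dense (D : Set E)) (hinv : ∀ t, ∀ ξ ∈ D, U t ξ ∈ D)
    (hdiff : ∀ ξ ∈ D, DifferentiableAt ℝ (fun t => U t ξ) 0)
    {ξ d : E} (hd : HasDerivAt (fun t => U t ξ) d 0) {ε : ℝ} (hε : 0 < ε) :
    ∃ η ∈ D, ∃ e, HasDerivAt (fun t => U t η) e 0 ∧ ‖η - ξ‖ < ε ∧ ‖e - d‖ < ε := by
  -- The range of `d/dt + 1`, that is of `iA + 1`, on `D`; its density is what makes `D` a core.
  let R : Submodule ℂ E :=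
    { carrier := {z | ∃ η ∈ D, ∃ e, HasDerivAt (fun t => U t η) e 0 ∧ z = e + η}
      add_mem' := by
        rintro _ _ ⟨η, hη, e, he, rfl⟩ ⟨η', hη', e', he', rfl⟩
        refine ⟨η + η', D.add_mem hη hη', e + e', ?_, by abel⟩
        simpa only [map_add] using he.fun_add he'
      zero_mem' := ⟨0, D.zero_mem, 0, by simpa using hasDerivAt_const (0 : ℝ) (0 : E), by simp⟩
      smul_mem' := by
        rintro c _ ⟨η, hη, e, he, rfl⟩
        refine ⟨c • η, D.smul_mem c hη, c • e, ?_, by rw [smul_add]⟩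
        simpa only [map_smul] using he.fun_const_smul c }
  have hR : Dense (R : Set E) := by
    rw [Submodule.dense_iff_topologicalClosure_eq_top, Submodule.topologicalClosure_eq_top_iff,
      Submodule.eq_bot_iff]
    intro ζ hζ
    rw [Submodule.mem_orthogonal'] at hζ
    have horth : ∀ η ∈ D, inner ℂ ζ η = 0 := by
      intro η hη
      -- Orthogonality to `R` at the vector `U t η`, which lies in `D` by invariance, says that
      -- `f(t) = ⟨ζ, U t η⟩` solves `f' = -f`.
      have hder : ∀ t, HasDerivAt (fun t => inner ℂ ζ (U t η)) (-inner ℂ ζ (U t η)) t := by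
        intro t
        have h1 := (hdiff _ (hinv t η hη)).hasDerivAt
        have h2 := hζ _ ⟨_, hinv t η hη, _, h1, rfl⟩
        rw [inner_add_right] at h2
        rw [← eq_neg_of_add_eq_zero_left h2]
        rw [← sub_self t] at h1
        have h3 := h1.comp_sub_const t t
        have h4 : HasDerivAt (fun s => U s η) (deriv (fun s => U s (U t η)) (t - t)) t := by
          convert h3 using 2 with s
          rw [← hadd, sub_add_cancel]
        have h5 := (hasDerivAt_const t ζ).inner ℂ h4
        simpa using h5
      have hexp : ∀ t, HasDerivAt (fun t : ℝ => (Real.exp t : ℂ) * inner ℂ ζ (U t η)) 0 t := by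
        intro t
        have h1 := (Real.hasDerivAt_exp t).ofReal_comp.mul (hder t)
        exact h1.congr_deriv (by simp)
      have hconst : ∀ t : ℝ, (Real.exp t : ℂ) * inner ℂ ζ (U t η) = inner ℂ ζ η := by
        intro t
        have := is_const_of_deriv_eq_zero (fun t => (hexp t).differentiableAt)
          (fun t => (hexp t).deriv) t 0
        simpa [hU0] using this
      -- The solution `e⁻ᵗ f(0)` is bounded by `‖ζ‖ ‖η‖`; letting `t → -∞` forces `f(0) = 0`.
      have hle : ∀ t : ℝ, ‖(inner ℂ ζ η : ℂ)‖ ≤ Real.exp t * (‖ζ‖ * ‖η‖) := by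
        intro t
        rw [← hconst t, norm_mul, Complex.norm_real, Real.norm_of_nonneg (Real.exp_pos t).le]
        gcongr
        rw [← hU t η]
        exact norm_inner_le_norm _ _
      have hlim : Filter.Tendsto (fun t : ℝ => Real.exp t * (‖ζ‖ * ‖η‖)) Filter.atBot (𝓝 0) := by
        simpa using Real.tendsto_exp_atBot.mul_const (‖ζ‖ * ‖η‖)
      exact norm_le_zero_iff.1 (ge_of_tendsto' hlim hle)
    have hall : (fun η => inner ℂ ζ η) = fun _ : E => (0 : ℂ) :=
      Continuous.ext_on hD (by fun_prop) continuous_const horth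
    exact inner_self_eq_zero.1 (congrFun hall ζ)
  obtain ⟨_, ⟨η, hη, e, he, rfl⟩, hlt⟩ := Metric.dense_iff.1 hR (d + ξ) ε hε |>.imp fun _ h => h.symm
  refine ⟨η, hη, e, he, ?_⟩
  -- By skew-symmetry `η - ξ` and `e - d` have inner product with zero real part. Pythagoras then
  -- bounds each of them by the norm of their sum, which is less than `ε`.
  have h1 : HasDerivAt (fun t => U t (η - ξ)) (e - d) 0 := by
    simpa only [map_sub] using he.fun_sub hd
  have h2 := re_inner_hasDerivAt_eq_zero hU0 hU h1
  rw [Metric.mem_ball, dist_eq_norm, show e + η - (d + ξ) = (η - ξ) + (e - d) by abel] at hlt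
  have h3 := norm_add_sq (𝕜 := ℂ) (η - ξ) (e - d)
  have h4 : RCLike.re (inner ℂ (η - ξ) (e - d)) = 0 := h2
  rw [h4] at h3
  constructor <;>
    nlinarith [norm_nonneg (η - ξ), norm_nonneg (e - d), norm_nonneg ((η - ξ) + (e - d))]

/-- Nonnegativity of the generator can be checked on an invariant dense subspace. -/
theorem im_inner_nonneg_of_core {U : ℝ → E →L[ℂ] E} (hU0 : ∀ ξ, U 0 ξ = ξ)
    (hadd : ∀ s t ξ, U (s + t) ξ = U s (U t ξ)) (hU : ∀ t ξ, ‖U t ξ‖ = ‖ξ‖)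
    (D : Submodule ℂ E) (hD : Dense (D : Set E)) (hinv : ∀ t, ∀ ξ ∈ D, U t ξ ∈ D)
    (hdiff : ∀ ξ ∈ D, DifferentiableAt ℝ (fun t => U t ξ) 0)
    (hpos : ∀ ξ ∈ D, ∀ d, HasDerivAt (fun t => U t ξ) d 0 → 0 ≤ (inner ℂ ξ d).im)
    {ξ d : E} (hd : HasDerivAt (fun t => U t ξ) d 0) : 0 ≤ (inner ℂ ξ d).im := by
  -- Nonnegativity of the form is a closed condition on the graph, and the core approximates in
  -- graph norm.
  have hcl : IsClosed {p : E × E | 0 ≤ (inner ℂ p.1 p.2).im} :=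
    isClosed_le continuous_const (Complex.continuous_im.comp (by fun_prop))
  have hmem : (ξ, d) ∈ closure {p : E × E | 0 ≤ (inner ℂ p.1 p.2).im} := by
    rw [Metric.mem_closure_iff]
    intro ε hε
    obtain ⟨η, hη, e, he, h1, h2⟩ := exists_core_approx hU0 hadd hU D hD hinv hdiff hd hε
    refine ⟨(η, e), hpos η hη e he, ?_⟩
    rw [dist_comm, Prod.dist_eq, dist_eq_norm, dist_eq_norm]
    exact max_lt h1 h2
  rw [hcl.closure_eq] at hmem
  exact hmem

end Core

/-! ### One-parameter subgroups of `MobTilde` and the adjoint action. -/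

noncomputable section

namespace Moebius

/-- The adjoint action of `SU(1,1)` on its Lie algebra, whose elements
`!![p.1, p.2; conj p.2, conj p.1]` (with imaginary `p.1`) are given by their first row. -/
def adjointAction (g : SU11) : ℂ × ℂ →ₗ[ℝ] ℂ × ℂ where
  toFun p :=
    ((coeffA g * p.1 + coeffB g * conj p.2) * conj (coeffA g) +
        (coeffA g * p.2 + coeffB g * conj p.1) * conj (-coeffB g),
      (coeffA g * p.1 + coeffB g * conj p.2) * (-coeffB g) +
        (coeffA g * p.2 + coeffB g * conj p.1) * coeffA g)
  map_add' p q := by ext1 <;> simp <;> ring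
  map_smul' c p := by ext1 <;> simp <;> ring

/-- Conjugation is real linear in the first row, so one formula serves group elements and tangent
vectors. Differentiating a conjugated subgroup is then the chain rule for a linear map. -/
theorem adjointAction_coeff (g x : SU11) :
    adjointAction g (coeffA x, coeffB x) = (coeffA (g * x * g⁻¹), coeffB (g * x * g⁻¹)) := by
  simp [adjointAction]

namespace MobTilde

instance : MeasurableSpace MobTilde := borel _

instance : BorelSpace MobTilde := ⟨rfl⟩

instance : LocallyCompactSpace MobTilde := homeo.isClosedEmbedding.locallyCompactSpace

/-- `γ` is a continuous one-parameter subgroup whose tangent vector at the identity has the first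
row `p`. -/
structure IsOneParam (γ : ℝ → MobTilde) (p : ℂ × ℂ) : Prop where
  continuous : Continuous γ
  add : ∀ s t, γ (s + t) = γ s * γ t
  hasDerivAt : HasDerivAt (fun s => (coeffA (γ s).mat, coeffB (γ s).mat)) p 0

namespace IsOneParam

variable {γ : ℝ → MobTilde} {p : ℂ × ℂ}

theorem zero (h : IsOneParam γ p) : γ 0 = 1 := by
  have := h.add 0 0
  rwa [add_zero, left_eq_mul] at this

theorem conjugate (h : IsOneParam γ p) (g : MobTilde) :
    IsOneParam (fun s => g * γ s * g⁻¹) (adjointAction g.mat p) where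
  continuous := (continuous_const.mul h.continuous).mul continuous_const
  add s t := by rw [h.add]; group
  hasDerivAt := by
    have h1 := (adjointAction g.mat).toContinuousLinearMap.hasFDerivAt.comp_hasDerivAt (0 : ℝ)
      h.hasDerivAt
    refine h1.congr_of_eventuallyEq (Filter.Eventually.of_forall fun s => ?_)
    simp only [mat_mul, mat_inv]
    exact (adjointAction_coeff g.mat (γ s).mat).symm

theorem hasDerivAt_coeffA (h : IsOneParam γ p) : HasDerivAt (fun s => coeffA (γ s).mat) p.1 0 :=
  (ContinuousLinearMap.fst ℝ ℂ ℂ).hasFDerivAt.comp_hasDerivAt (0 : ℝ) h.hasDerivAt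

theorem hasDerivAt_coeffB (h : IsOneParam γ p) : HasDerivAt (fun s => coeffB (γ s).mat) p.2 0 :=
  (ContinuousLinearMap.snd ℝ ℂ ℂ).hasFDerivAt.comp_hasDerivAt (0 : ℝ) h.hasDerivAt

end IsOneParam

theorem _root_.Complex.hasDerivAt_arg_of_eq_one {f : ℝ → ℂ} {f' : ℂ} {t : ℝ}
    (hf : HasDerivAt f f' t) (h1 : f t = 1) : HasDerivAt (fun s => (f s).arg) f'.im t := by
  have h2 := hf.clog_real (by simp [h1])
  rw [h1, div_one] at h2
  have h3 := Complex.imCLM.hasFDerivAt.comp_hasDerivAt t h2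
  simp only [Function.comp_def, Complex.imCLM_apply, Complex.log_im] at h3
  exact h3

/-- Near `0` the angle lies in `(-π, π)`, so it equals the principal argument of `a`, whose
derivative at the point `1` is the imaginary part. -/
theorem IsOneParam.hasDerivAt_angle {γ : ℝ → MobTilde} {p : ℂ × ℂ} (h : IsOneParam γ p) :
    HasDerivAt (fun s => (γ s).angle) p.1.im 0 := by
  have h1 := Complex.hasDerivAt_arg_of_eq_one h.hasDerivAt_coeffA (by simp [h.zero])
  refine h1.congr_of_eventuallyEq ?_
  have hc : Continuous fun s => (γ s).angle := continuous_angle.comp h.continuous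
  have he : ∀ᶠ s in 𝓝 (0 : ℝ), |(γ s).angle| < Real.pi :=
    hc.abs.continuousAt.eventually_lt continuousAt_const (by simp [h.zero, Real.pi_pos])
  filter_upwards [he] with s hs
  rw [abs_lt] at hs
  rw [coeffA_mat (γ s), Complex.exp_mul_I, Complex.arg_mul_cos_add_sin_mul_I
    (norm_pos_iff.2 (coeffA_ne_zero _)) ⟨hs.1, hs.2.le⟩]

/-! ### The right-invariant flows in the global chart. -/

/-- The velocity at `g`, in the coordinates of `homeo`, of the right-invariant flow
`s ↦ (γ s)⁻¹ g` generated by a tangent vector. -/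
def velocity (g : MobTilde) : ℂ × ℂ →ₗ[ℝ] ℂ × ℝ where
  toFun p := (conj p.1 * coeffB g.mat - p.2 * conj (coeffA g.mat),
    -p.1.im - (p.2 * (conj (coeffB g.mat) / coeffA g.mat)).im)
  map_add' p q := by
    ext1
    · simp; ring
    · simp only [Prod.fst_add, Prod.snd_add, add_mul, Complex.add_im]; ring
  map_smul' c p := by
    ext1
    · simp; ring
    · simp only [Prod.smul_fst, Prod.smul_snd, smul_mul_assoc, Complex.smul_im, smul_eq_mul,
        RingHom.id_apply]
      ring

theorem velocity_apply (g : MobTilde) (p : ℂ × ℂ) : velocity g p =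
    (conj p.1 * coeffB g.mat - p.2 * conj (coeffA g.mat),
      -p.1.im - (p.2 * (conj (coeffB g.mat) / coeffA g.mat)).im) := rfl

theorem continuous_velocity (p : ℂ × ℂ) : Continuous fun g => velocity g p := by
  have hA := continuous_coeffA.comp continuous_mat
  have hB := continuous_coeffB.comp continuous_mat
  have hd : Continuous fun g : MobTilde => conj (coeffB g.mat) / coeffA g.mat :=
    (Complex.continuous_conj.comp hB).div hA fun _ => coeffA_ne_zero _
  exact ((continuous_const.mul hB).sub
    (continuous_const.mul (Complex.continuous_conj.comp hA))).prodMk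
    (continuous_const.sub (Complex.continuous_im.comp (continuous_const.mul hd)))

theorem IsOneParam.hasDerivAt_homeo {γ : ℝ → MobTilde} {p : ℂ × ℂ} (h : IsOneParam γ p)
    (g : MobTilde) : HasDerivAt (fun s => homeo ((γ s)⁻¹ * g)) (velocity g p) 0 := by
  have hA := h.hasDerivAt_coeffA
  have hB := h.hasDerivAt_coeffB
  have hA' : HasDerivAt (fun s => conj (coeffA (γ s).mat)) (conj p.1) 0 :=
    Complex.conjCLE.toContinuousLinearMap.hasFDerivAt.comp_hasDerivAt (0 : ℝ) hA
  have h1 : HasDerivAt (fun s => coeffB ((γ s)⁻¹ * g).mat) (velocity g p).1 0 := by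
    have h2 := (hA'.mul_const (coeffB g.mat)).add (hB.neg.mul_const (conj (coeffA g.mat)))
    have h3 : (velocity g p).1 =
        conj p.1 * coeffB g.mat + -p.2 * conj (coeffA g.mat) := by
      rw [velocity_apply]; ring
    rw [h3]
    refine h2.congr_of_eventuallyEq (Filter.Eventually.of_forall fun s => ?_)
    simp
  -- The cocycle is `1 - b(γ) conj b(g) / (conj a(γ) a(g))`. It equals `1` at `s = 0`, and there
  -- only the derivative of `b(γ)` contributes, since `b(γ 0) = 0`.
  have hc : HasDerivAt (fun s => cocycle (γ s)⁻¹.mat g.mat)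
      (-(p.2 * (conj (coeffB g.mat) / coeffA g.mat))) 0 := by
    have h2 := ((hB.neg.mul_const (conj (coeffB g.mat))).div (hA'.mul_const (coeffA g.mat))
      (by simp [h.zero, coeffA_ne_zero])).const_add 1
    have hg := coeffA_ne_zero g.mat
    refine (h2.congr_of_eventuallyEq (Filter.Eventually.of_forall fun s => ?_)).congr_deriv ?_
    · have hs : conj (coeffA (γ s).mat) ≠ 0 := by simp [coeffA_ne_zero]
      simp only [cocycle, mat_inv, coeffA_mul, coeffA_inv, coeffB_inv, Pi.neg_apply,
        Pi.div_apply]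
      field_simp
    · simp [h.zero]
      field_simp
  have h2 : HasDerivAt (fun s => ((γ s)⁻¹ * g).angle) (velocity g p).2 0 := by
    have h3 := Complex.hasDerivAt_arg_of_eq_one hc (by
      simp [h.zero, cocycle, coeffA_ne_zero])
    exact (h.hasDerivAt_angle.neg.add_const g.angle).add h3 |>.congr_deriv (by
      rw [velocity_apply, Complex.neg_im, ← sub_eq_add_neg])
  exact h1.prodMk h2

end MobTilde

/-! ### Differentiable vectors: invariance and density. -/

open MobTilde MeasureTheory

variable {E : Type*} [NormedAddCommGroup E] [InnerProductSpace ℂ E] [CompleteSpace E]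

/-- The vectors which are differentiable along all one-parameter subgroups, with a derivative
depending linearly on the tangent vector. -/
def differentiableVectors (V : MobTilde →* unitary (E →L[ℂ] E)) : Submodule ℂ E where
  carrier := {v | ∃ L : ℂ × ℂ →ₗ[ℝ] E, ∀ γ p, IsOneParam γ p →
    HasDerivAt (fun s => (V (γ s) : E →L[ℂ] E) v) (L p) 0}
  add_mem' := by
    rintro v w ⟨L, hL⟩ ⟨M, hM⟩
    refine ⟨L + M, fun γ p h => ?_⟩
    simpa only [map_add, LinearMap.add_apply] using (hL γ p h).fun_add (hM γ p h)
  zero_mem' := ⟨0, fun γ p _ => by simpa using hasDerivAt_const (0 : ℝ) (0 : E)⟩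
  smul_mem' := by
    rintro c v ⟨L, hL⟩
    refine ⟨c • L, fun γ p h => ?_⟩
    simpa only [map_smul, LinearMap.smul_apply] using (hL γ p h).fun_const_smul c

variable {V : MobTilde →* unitary (E →L[ℂ] E)}

/-- From `V(γ) V(g) v = V(g) V(g⁻¹ γ g) v`: the new derivative map is `V(g) ∘ L ∘ Ad(g⁻¹)`. -/
theorem unitaryRep_mem_differentiableVectors (g : MobTilde) {v : E}
    (hv : v ∈ differentiableVectors V) :
    (V g : E →L[ℂ] E) v ∈ differentiableVectors V := by
  obtain ⟨L, hL⟩ := hv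
  refine ⟨((V g : E →L[ℂ] E).toLinearMap.restrictScalars ℝ) ∘ₗ L ∘ₗ
    adjointAction (g⁻¹).mat, fun γ p h => ?_⟩
  have h1 := hL _ _ (h.conjugate g⁻¹)
  have h2 := ((V g : E →L[ℂ] E).restrictScalars ℝ).hasFDerivAt.comp_hasDerivAt (0 : ℝ) h1
  refine h2.congr_of_eventuallyEq (Filter.Eventually.of_forall fun s => ?_)
  simp only [Function.comp_apply, ContinuousLinearMap.coe_restrictScalars',
    ← unitaryRep_mul_apply]
  group

variable (hV : ∀ ξ : E, Continuous fun g : MobTilde => (V g : E →L[ℂ] E) ξ)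
include hV

/-- The derivative is the smearing with `dφ(velocity g p)`, and linearity in `p` comes from that of
`velocity g`. One continuous derivative of `φ` is enough. -/
theorem smear_mem_differentiableVectors {φ : ℂ × ℝ → ℝ} (hφ : ContDiff ℝ 1 φ)
    (hs : HasCompactSupport φ) (ξ : E) :
    smear Measure.haar V (φ ∘ homeo) ξ ∈ differentiableVectors V := by
  have hX : ∀ p, Continuous fun g => fderiv ℝ φ (homeo g) (velocity g p) := fun p =>
    ((hφ.continuous_fderiv one_ne_zero).comp homeo.continuous).clm_apply (continuous_velocity p)
  have hXs : ∀ p, HasCompactSupport fun g => fderiv ℝ φ (homeo g) (velocity g p) := fun p =>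
    ((hs.fderiv ℝ).comp_homeomorph homeo).mono' fun g hg => subset_tsupport _ fun h => hg (by
      have h' : fderiv ℝ φ (homeo g) = 0 := h
      simp [h'])
  have hi := fun p => integrable_smear Measure.haar hV (hX p) (hXs p) ξ
  refine ⟨{
    toFun := fun p => smear Measure.haar V (fun g => fderiv ℝ φ (homeo g) (velocity g p)) ξ
    map_add' := fun p q => by
      rw [smear, smear, smear, ← integral_add (hi p) (hi q)]
      simp only [map_add, add_smul]
    map_smul' := fun c p => by
      rw [smear, smear, RingHom.id_apply, ← integral_smul]
      simp only [map_smul, smul_eq_mul, mul_smul] }, fun γ p h => ?_⟩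
  refine hasDerivAt_unitaryRep_smear Measure.haar hV (hφ.continuous.comp homeo.continuous)
    (hs.comp_homeomorph homeo) (hX p) h.continuous h.add (fun g => ?_) ξ
  have h1 := (hφ.differentiable one_ne_zero (homeo ((γ 0)⁻¹ * g))).hasFDerivAt.comp_hasDerivAt
    (0 : ℝ) (h.hasDerivAt_homeo g)
  rw [h.zero, inv_one, one_mul] at h1
  exact h1

theorem dense_differentiableVectors : Dense (differentiableVectors V : Set E) := by
  rw [Metric.dense_iff]
  intro ξ ε hε
  have hU : {g : MobTilde | ‖(V g : E →L[ℂ] E) ξ - ξ‖ < ε / 2} ∈ 𝓝 (1 : MobTilde) :=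
    (isOpen_lt ((hV ξ).sub continuous_const).norm continuous_const).mem_nhds
      (by simp [hε])
  have hU' : homeo.symm ⁻¹' {g : MobTilde | ‖(V g : E →L[ℂ] E) ξ - ξ‖ < ε / 2} ∈
      𝓝 (homeo 1) :=
    homeo.symm.continuous.continuousAt.preimage_mem_nhds (by simpa using hU)
  obtain ⟨r, hr, hball⟩ := Metric.mem_nhds_iff.1 hU'
  -- A bump in the chart around the identity, supported where `V` moves `ξ` by less than `ε / 2`.
  -- Dividing by its Haar integral `m` turns it into a probability density.
  let φ : ContDiffBump (homeo 1) := ⟨r / 2, r, by positivity, by linarith⟩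
  have hc : Continuous (φ ∘ homeo) := φ.continuous.comp homeo.continuous
  have hs : HasCompactSupport (φ ∘ homeo) := φ.hasCompactSupport.comp_homeomorph homeo
  have hpos : 0 < ∫ g, (φ ∘ homeo) g ∂(Measure.haar : Measure MobTilde) :=
    hc.integral_pos_of_hasCompactSupport_nonneg_nonzero hs (fun g => φ.nonneg) (x := 1)
      (φ.pos_of_mem_ball (Metric.mem_ball_self φ.rOut_pos)).ne'
  set m := ∫ g, (φ ∘ homeo) g ∂(Measure.haar : Measure MobTilde)
  refine ⟨_, ?_, smear_mem_differentiableVectors hV (φ := fun x => m⁻¹ * φ x)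
    (contDiff_const.mul φ.contDiff) φ.hasCompactSupport.mul_left ξ⟩
  rw [Metric.mem_ball, dist_eq_norm]
  refine (norm_smear_sub_le Measure.haar hV (continuous_const.mul hc) hs.mul_left
    (fun g => mul_nonneg (inv_nonneg.2 hpos.le) φ.nonneg) ?_ ξ fun g hg => ?_).trans_lt
    (half_lt_self hε)
  · simp only [Pi.mul_apply]
    rw [integral_const_mul, inv_mul_cancel₀ hpos.ne']
  · have h1 : homeo g ∈ Metric.ball (homeo 1) r := by
      have : homeo g ∈ Function.support φ := right_ne_zero_of_mul hg
      rwa [φ.support_eq] at this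
    have h2 := hball h1
    simp only [Set.mem_preimage, Homeomorph.symm_apply_apply] at h2
    exact le_of_lt h2

end Moebius

end

/-! ### Tangent vectors of rotations and translations, and their conjugates. -/

noncomputable section

namespace Moebius

namespace MobTilde

theorem isOneParam_rotation : IsOneParam rotation (I / 2, 0) where
  continuous := continuous_rotation
  add := rotation_add
  hasDerivAt := by
    simp only [coeffA_rotation, coeffB_rotation]
    have h1 : HasDerivAt (fun s : ℝ => ((s / 2 : ℝ) : ℂ) * I) (I / 2) 0 := by
      have h := (((hasDerivAt_id (0 : ℝ)).div_const 2).ofReal_comp).mul_const I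
      exact h.congr_deriv (by push_cast; ring)
    exact (h1.cexp.congr_deriv (by simp)).prodMk (hasDerivAt_const _ _)

theorem isOneParam_translation : IsOneParam translation (I / 4, -(I / 4)) where
  continuous := continuous_translation
  add := translation_add
  hasDerivAt := by
    simp only [coeffA_translation, coeffB_translation]
    have h1 : HasDerivAt (fun s : ℝ => ((s / 4 : ℝ) : ℂ) * I) (I / 4) 0 := by
      have h := (((hasDerivAt_id (0 : ℝ)).div_const 4).ofReal_comp).mul_const I
      exact h.congr_deriv (by push_cast; ring)
    exact (h1.const_add 1).prodMk h1.neg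

/-- The lift of the dilation fixing `1` and `-1` with multiplier `r ^ 2` at `-1`. -/
def dilation (r : ℝ) (hr : 0 < r) : MobTilde :=
  ⟨(mkSU11 (((r + r⁻¹) / 2 : ℝ) : ℂ) (((r - r⁻¹) / 2 : ℝ) : ℂ) (by
      rw [Complex.conj_ofReal, Complex.conj_ofReal]
      norm_cast
      field_simp
      ring), 0), by
    have h : 0 ≤ (r + r⁻¹) / 2 := by positivity
    rw [coeffA_mk, Complex.norm_real, Real.norm_of_nonneg h]
    simp⟩

theorem coeffA_dilation (r : ℝ) (hr : 0 < r) :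
    coeffA (dilation r hr).mat = (((r + r⁻¹) / 2 : ℝ) : ℂ) := by
  simp only [dilation, mat, coeffA_mk]

theorem coeffB_dilation (r : ℝ) (hr : 0 < r) :
    coeffB (dilation r hr).mat = (((r - r⁻¹) / 2 : ℝ) : ℂ) := by
  simp only [dilation, mat, coeffB_mk]

/-- Translations and dilations both fix the point `1`, and conjugation by a dilation only rescales
the translation parameter. -/
theorem adjointAction_dilation_translation (r : ℝ) (hr : 0 < r) :
    adjointAction (dilation r hr).mat (I / 4, -(I / 4)) = r ^ 2 • (I / 4, -(I / 4)) := by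
  have h : (r : ℂ) ≠ 0 := Complex.ofReal_ne_zero.2 hr.ne'
  ext1 <;>
  · simp only [adjointAction, LinearMap.coe_mk, AddHom.coe_mk, coeffA_dilation, coeffB_dilation,
      map_div₀, map_neg, Complex.conj_I, Complex.conj_ofReal, Prod.smul_mk, Complex.real_smul,
      Complex.conj_ofNat]
    push_cast
    field_simp
    ring

/-- The rotation tangent splits into the tangents of the translations fixing `1` and of those fixing
`-1`. The dilation, which fixes both points, scales the two summands inversely. -/
theorem adjointAction_dilation_rotation (r : ℝ) (hr : 0 < r) :
    adjointAction (dilation r hr).mat (I / 2, 0) =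
      r ^ 2 • (I / 4, -(I / 4)) + (r⁻¹) ^ 2 • (I / 4, I / 4) := by
  have h : (r : ℂ) ≠ 0 := Complex.ofReal_ne_zero.2 hr.ne'
  ext1 <;>
  · simp only [adjointAction, LinearMap.coe_mk, AddHom.coe_mk, coeffA_dilation, coeffB_dilation,
      map_div₀, map_neg, Complex.conj_I, Complex.conj_ofReal, Prod.smul_mk, Complex.real_smul,
      Complex.conj_ofNat, map_zero, Prod.mk_add_mk]
    push_cast
    field_simp
    ring

theorem adjointAction_rotation_pi_translation :
    adjointAction (rotation Real.pi).mat (I / 4, -(I / 4)) = (I / 4, I / 4) := by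
  have h : exp ((Real.pi / 2 : ℝ) * I) = I := by
    push_cast; exact Complex.exp_pi_div_two_mul_I
  have h2 := Complex.I_mul_I
  simp only [adjointAction, LinearMap.coe_mk, AddHom.coe_mk, coeffA_rotation, coeffB_rotation, h]
  ext1 <;> simp <;> linear_combination (-I / 4) * h2

end MobTilde

open MobTilde

variable {E : Type*} [NormedAddCommGroup E] [InnerProductSpace ℂ E] [CompleteSpace E]
  {V : MobTilde →* unitary (E →L[ℂ] E)}

/-- A lower bound of the generator of a one-parameter subgroup is a lower bound of the generators of
all its conjugates. -/
theorem le_im_inner_conjugate {γ : ℝ → MobTilde} {p : ℂ × ℂ} (h : IsOneParam γ p) {c : ℝ}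
    (hc : ∀ ξ d : E, HasDerivAt (fun s => (V (γ s) : E →L[ℂ] E) ξ) d 0 →
      c * ‖ξ‖ ^ 2 ≤ (inner ℂ ξ d).im)
    {v : E} {L : ℂ × ℂ →ₗ[ℝ] E} (hL : ∀ γ p, IsOneParam γ p →
      HasDerivAt (fun s => (V (γ s) : E →L[ℂ] E) v) (L p) 0) (g : MobTilde) :
    c * ‖v‖ ^ 2 ≤ (inner ℂ v (L (adjointAction g.mat p))).im := by
  -- The bound is applied to `w = V(g⁻¹) v`: unitarity gives `‖w‖ = ‖v‖` and turns the expectation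
  -- along `γ` in `w` into that along `g γ g⁻¹` in `v`.
  have h1 := ((V g⁻¹ : E →L[ℂ] E).restrictScalars ℝ).hasFDerivAt.comp_hasDerivAt (0 : ℝ)
    (hL _ _ (h.conjugate g))
  have h2 := hc ((V g⁻¹ : E →L[ℂ] E) v) _
    (h1.congr_of_eventuallyEq (Filter.Eventually.of_forall fun s => by
      simp only [Function.comp_apply, ContinuousLinearMap.coe_restrictScalars',
        ← unitaryRep_mul_apply]
      group))
  rwa [ContinuousLinearMap.coe_restrictScalars', norm_unitaryRep_apply,
    inner_unitaryRep_apply] at h2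

/-- Reduces the nonnegativity of a generator to the differentiable vectors, where the form is linear
on the Lie algebra. -/
theorem isNonnegative_of_differentiableVectors
    (hV : ∀ ξ : E, Continuous fun g : MobTilde => (V g : E →L[ℂ] E) ξ)
    {γ : ℝ → MobTilde} {p : ℂ × ℂ} (h : IsOneParam γ p)
    (hpos : ∀ (v : E) (L : ℂ × ℂ →ₗ[ℝ] E), (∀ γ p, IsOneParam γ p →
      HasDerivAt (fun s => (V (γ s) : E →L[ℂ] E) v) (L p) 0) → 0 ≤ (inner ℂ v (L p)).im) :
    IsNonnegative (unitaryGenerator fun s => (V (γ s) : E →L[ℂ] E)) := by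
  rw [isNonnegative_unitaryGenerator_iff]
  intro ξ d hd
  refine im_inner_nonneg_of_core (fun ξ => ?_) (fun s t ξ => ?_) (fun t ξ => ?_)
    (differentiableVectors V) (dense_differentiableVectors hV)
    (fun t ξ hξ => unitaryRep_mem_differentiableVectors _ hξ) ?_ ?_ hd
  · rw [h.zero, unitaryRep_one_apply]
  · rw [h.add, unitaryRep_mul_apply]
  · exact norm_unitaryRep_apply V _ ξ
  · rintro v ⟨L, hL⟩
    exact (hL γ p h).differentiableAt
  · rintro v ⟨L, hL⟩ e he
    rw [he.unique (hL γ p h)]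
    exact hpos v L hL

theorem nonneg_of_forall_le_sq_mul_add {c q q' : ℝ}
    (h : ∀ r : ℝ, 0 < r → c ≤ r ^ 2 * q + (r⁻¹) ^ 2 * q') : 0 ≤ q := by
  have hlim : Filter.Tendsto (fun u : ℝ => u ^ 2 * c - u ^ 4 * q') (𝓝[>] 0) (𝓝 0) := by
    have hc : Continuous fun u : ℝ => u ^ 2 * c - u ^ 4 * q' := by fun_prop
    simpa using (hc.tendsto 0).mono_left nhdsWithin_le_nhds
  refine le_of_tendsto hlim ?_
  -- With `r = u⁻¹`, multiplying the hypothesis by `u ^ 2` gives `u ^ 2 * c - u ^ 4 * q' ≤ q`, whose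
  -- left side tends to `0` as `u → 0`.
  filter_upwards [self_mem_nhdsWithin] with u hu
  have hu' : (0 : ℝ) < u := hu
  have h1 := mul_le_mul_of_nonneg_left (h u⁻¹ (inv_pos.2 hu')) (sq_nonneg u)
  have h2 : u ^ 2 * (u⁻¹ ^ 2 * q + u⁻¹⁻¹ ^ 2 * q') = q + u ^ 4 * q' := by
    field_simp
  linarith

end Moebius

end

/-! ### The equivalence of the four conditions. -/

open Moebius Moebius.MobTilde

/-- For a strongly continuous unitary representation `V` of the universal covering group of the Möbius
group, with `H` and `P` the selfadjoint generators of rotations and translations,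
boundedness from below and nonnegativity of `H` and of `P` are all equivalent. -/
theorem lemma3p1 {E : Type*} [NormedAddCommGroup E] [InnerProductSpace ℂ E] [CompleteSpace E]
    (V : Moebius.MobTilde →* unitary (E →L[ℂ] E))
    (hV : ∀ ξ : E, Continuous fun g : Moebius.MobTilde => (V g : E →L[ℂ] E) ξ)
    (H P : E →ₗ.[ℂ] E)
    (hH : H = unitaryGenerator fun α : ℝ => (V (Moebius.MobTilde.rotation α) : E →L[ℂ] E))
    (hP : P = unitaryGenerator fun a : ℝ => (V (Moebius.MobTilde.translation a) : E →L[ℂ] E)) :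
    List.TFAE [IsBoundedFromBelow H, IsBoundedFromBelow P, IsNonnegative H, IsNonnegative P] := by
  subst hH hP
  tfae_have 1 → 4 := by
    rw [isBoundedFromBelow_unitaryGenerator_iff]
    rintro ⟨c, hc⟩
    refine isNonnegative_of_differentiableVectors hV isOneParam_translation fun v L hL => ?_
    -- Here `q'` is the expectation of the translations fixing `-1`. No sign is known for it, and
    -- none is needed, as its coefficient dies in the limit.
    refine nonneg_of_forall_le_sq_mul_add (c := c * ‖v‖ ^ 2)
      (q' := (inner ℂ v (L (I / 4, I / 4))).im) fun r hr => ?_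
    have h := le_im_inner_conjugate isOneParam_rotation hc hL (dilation r hr)
    rw [adjointAction_dilation_rotation, map_add, map_smul, map_smul,
      inner_add_right, inner_smul_right_eq_smul, inner_smul_right_eq_smul] at h
    simpa only [Complex.add_im, Complex.smul_im, smul_eq_mul, mul_zero, add_zero] using h
  tfae_have 2 → 4 := by
    rw [isBoundedFromBelow_unitaryGenerator_iff]
    rintro ⟨c, hc⟩
    refine isNonnegative_of_differentiableVectors hV isOneParam_translation fun v L hL => ?_
    -- A translation tangent is only rescaled, so there is no second term.
    refine nonneg_of_forall_le_sq_mul_add (c := c * ‖v‖ ^ 2) (q' := 0) fun r hr => ?_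
    have h := le_im_inner_conjugate isOneParam_translation hc hL (dilation r hr)
    rw [adjointAction_dilation_translation, map_smul, inner_smul_right_eq_smul] at h
    simpa only [Complex.add_im, Complex.smul_im, smul_eq_mul, mul_zero, add_zero] using h
  tfae_have 4 → 3 := by
    intro h4
    have hc := isNonnegative_unitaryGenerator_iff.1 h4
    refine isNonnegative_of_differentiableVectors hV isOneParam_rotation fun v L hL => ?_
    have h1 := hc v _ (hL _ _ isOneParam_translation)
    -- The bound `0` passes to the translations fixing `-1`, which are conjugate to the original
    -- ones under the rotation by `π`.
    have h2 := le_im_inner_conjugate (c := 0) isOneParam_translation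
      (fun ξ d hd => by simpa using hc ξ d hd) hL (rotation Real.pi)
    rw [adjointAction_rotation_pi_translation, zero_mul] at h2
    have h3 : ((I / 2, 0) : ℂ × ℂ) = (I / 4, -(I / 4)) + (I / 4, I / 4) := by
      ext1 <;> simp <;> ring
    rw [h3, map_add, inner_add_right, Complex.add_im]
    exact add_nonneg h1 h2
  tfae_have 3 → 1 := fun h => ⟨0, fun ξ => by simpa using h ξ⟩
  tfae_have 4 → 2 := fun h => ⟨0, fun ξ => by simpa using h ξ⟩
  tfae_finish
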